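/- Let $\Omega$ be a finite set, $n$ a positive integer, $H:\Omega\to\{0,\dots,n\}$ a Hamiltonian with at least one state of energy $0$, and put $$Z(\beta)=\sum_{x\in\Omega}e^{-\beta H(x)},\qquad \mu_\beta(x)=\frac{e^{-\beta H(x)}}{Z(\beta)}\quad(\beta\ge 0),\qquad q=\ln|\Omega| .$$ Assume $\ln n\ge 1$, $\ln q\ge 1$ and $|\Omega|\ge\ln n$. Let $0\le\beta_{\min}<\beta_{\max}$, $\varepsilon\in(0,1)$ and $Q=Z(\beta_{\max})/Z(\beta_{\min})$. A (classical) Gibbs sampling algorithm is given $n$, $|\Omega|$, $\beta_{\min}$, $\beta_{\max}$ and $\varepsilon$, but not $H$. At every step, depending on these inputs and on the answers received so far, it either requests a fresh sample $x\sim\mu_\beta$ at an inverse temperature $\beta\ge 0$ of its choice and receives the energy $H(x)$, or stops and outputs a real number; its cost is the number of samples requested. There is such an algorithm, the same for all $\Omega$ and $H$, which under the above assumptions always uses at most $$5\cdot10^5\, q\ln^2 n\,(\ln q+\ln n)^2+7\cdot10^9\, q\ln^2 n\;\varepsilon^{-2}$$ Gibbs samples, in particular $\tilde O(q\,\varepsilon^{-2})$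 of them (at most $C\,q\,\varepsilon^{-2}(\ln q+\ln n)^k$ with universal constants $C$ and $k$), and which, with probability at least $4/5$, outputs $\widehat Q$ with $$(1-\varepsilon)\,Q\le\widehat Q\le(1+\varepsilon)\,Q .$$ -/

import Mathlib

namespace GibbsSampling

/-- The partition function `Z(β) = ∑ x, exp (-β H(x))` of a Hamiltonian with values in `ℕ`. -/
noncomputable def partitionFunction {Ω : Type*} [Fintype Ω] (H : Ω → ℕ) (β : ℝ) : ℝ :=
  ∑ x, Real.exp (-β * (H x : ℝ))

theorem partitionFunction_pos {Ω : Type*} [Fintype Ω] [Nonempty Ω] (H : Ω → ℕ) (β : ℝ) :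
    0 < partitionFunction H β :=
  Finset.sum_pos (fun _ _ => Real.exp_pos _) Finset.univ_nonempty

/-- The Gibbs distribution `μ_β(x) = exp (-β H(x)) / Z(β)` at inverse temperature `β ≥ 0`. -/
noncomputable def gibbs {Ω : Type*} [Fintype Ω] [Nonempty Ω] (H : Ω → ℕ) (β : NNReal) : PMF Ω :=
  PMF.ofFintype
    (fun x => ENNReal.ofReal (Real.exp (-(β : ℝ) * (H x : ℝ)) / partitionFunction H β)) (by
      rw [← ENNReal.ofReal_sum_of_nonneg
        (fun x _ => div_nonneg (Real.exp_pos _).le (partitionFunction_pos H β).le),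
        ← Finset.sum_div]
      change ENNReal.ofReal (partitionFunction H β / partitionFunction H β) = 1
      rw [div_self (partitionFunction_pos H β).ne', ENNReal.ofReal_one])

/-- An adaptive algorithm with access to Gibbs samples of an unknown Hamiltonian, as a decision
tree: it either stops with a real output, or asks for a fresh sample `x` from the Gibbs
distribution at an inverse temperature `β ≥ 0` of its choice, is told the energy `H(x)`, and
continues depending on that energy. Every run is finite. The tree does not depend on `H`. -/
inductive Algorithm : Type
  | output (estimate : ℝ) : Algorithm
  | sample (β : NNReal) (next : ℕ → Algorithm) : Algorithm

/-- The joint law of the output and of the number of Gibbs samples used, when the algorithm runs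
on the Hamiltonian `H`. All samples are drawn independently of the past, given the requested
inverse temperature. -/
noncomputable def Algorithm.run {Ω : Type*} [Fintype Ω] [Nonempty Ω] (H : Ω → ℕ) :
    Algorithm → PMF (ℝ × ℕ)
  | .output r => PMF.pure (r, 0)
  | .sample β next =>
      (gibbs H β).bind fun x => (Algorithm.run H (next (H x))).map fun p => (p.1, p.2 + 1)

end GibbsSampling

/-!
The algorithm is not adaptive. Along inverse temperatures `β₀ ≤ β₁ ≤ …` from `βmin` to `βmax`, it
draws one sample `xᵢ` at each `βᵢ` and outputs `∏ exp (-(βᵢ₊₁ - βᵢ) H(xᵢ))`. The factors are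
independent with means `Z(βᵢ₊₁) / Z(βᵢ)`, so that the product is an unbiased estimator of `Q`
(`expect_productEstimator`), and by Chebyshev's inequality (`relative_error_le`) it suffices that
its relative second moment is at most `1 + ε ^ 2 / 5`.

For `N` equal steps of length `h` from `a` to `b` the relative second moment is a telescoping
product and is at most `Z(a) / Z(a + h)` (`equalSteps_controlled`). By Jensen's inequality this is
at most `exp (h D(a))`, where `D(a)` is the mean energy at `a`. Now `D(a) ≤ n`, and convexity of
`log Z` gives `a D(a) ≤ q`; so on an interval from `(2 ^ i - 1) q / n` to `(2 ^ (i + 1) - 1) q / n`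
the exponent is at most `2 q / N`. About `log₂ n` such intervals reach beyond `q`, where
`D(a) ≤ exp (q - a)`, so that the number of steps per interval may decrease geometrically until
the remaining variance is negligible (`annealingSchedule_controlled`). With `N` of the order
`q ln n / ε ^ 2` the relative variance is at most `ε ^ 2 / 5`, and the number of samples is of the
order `q ln² n / ε ^ 2`.
-/

namespace GibbsSampling

open scoped ENNReal

/-! ### Expectations under a discrete distribution -/

/-- The expectation of an `ℝ≥0∞`-valued function under a discrete distribution. -/
noncomputable def expect {α : Type*} (μ : PMF α) (f : α → ℝ≥0∞) : ℝ≥0∞ := ∑' a, μ a * f a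

theorem expect_pure {α : Type*} (a : α) (f : α → ℝ≥0∞) : expect (PMF.pure a) f = f a := by
  classical
  unfold expect
  rw [tsum_eq_single a]
  · simp
  · intro b hb
    simp [PMF.pure_apply, hb]

theorem expect_bind {α β : Type*} (μ : PMF α) (k : α → PMF β) (f : β → ℝ≥0∞) :
    expect (μ.bind k) f = expect μ fun a => expect (k a) f := by
  unfold expect
  simp_rw [PMF.bind_apply, ← ENNReal.tsum_mul_right, ← ENNReal.tsum_mul_left]
  rw [ENNReal.tsum_comm]
  simp_rw [mul_assoc]

theorem expect_map {α β : Type*} (μ : PMF α) (g : α → β) (f : β → ℝ≥0∞) :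
    expect (μ.map g) f = expect μ (f ∘ g) := by
  rw [← PMF.bind_pure_comp, expect_bind]
  simp only [Function.comp_apply, expect_pure, Function.comp_def]

/-- Chebyshev's inequality: a nonnegative random variable with mean `Q` and second moment at most
`(1 + δ) * Q ^ 2`, where `δ ≤ ε ^ 2 / 5`, has relative error at most `ε` with probability at least
`4 / 5`. -/
theorem relative_error_le {α : Type*} (μ : PMF α) (X : α → ℝ) (hX : ∀ a ∈ μ.support, 0 ≤ X a)
    {Q δ ε : ℝ} (hQ : 0 < Q) (hε : 0 < ε) (hδ : δ ≤ ε ^ 2 / 5)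
    (h1 : expect μ (fun a => ENNReal.ofReal (X a)) = ENNReal.ofReal Q)
    (h2 : expect μ (fun a => ENNReal.ofReal (X a ^ 2)) ≤ ENNReal.ofReal ((1 + δ) * Q ^ 2)) :
    4 / 5 ≤ μ.toOuterMeasure {a | (1 - ε) * Q ≤ X a ∧ X a ≤ (1 + ε) * Q} := by
  classical
  set S : Set α := {a | (1 - ε) * Q ≤ X a ∧ X a ≤ (1 + ε) * Q} with hS
  set P := μ.toOuterMeasure S with hP
  have hPsum : P = expect μ (S.indicator 1) := by
    rw [hP, PMF.toOuterMeasure_apply]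
    unfold expect
    refine tsum_congr fun a => ?_
    by_cases ha : a ∈ S <;> simp [ha]
  have hle : P ≤ 1 := by
    rw [hPsum, ← μ.tsum_coe]
    refine ENNReal.tsum_le_tsum fun a => ?_
    by_cases ha : a ∈ S <;> simp [ha]
  have hadd : ∀ f g : α → ℝ≥0∞, expect μ (f + g) = expect μ f + expect μ g := fun f g => by
    unfold expect
    rw [← ENNReal.tsum_add]
    simp [mul_add]
  have hmul : ∀ (c : ℝ≥0∞) (f : α → ℝ≥0∞), expect μ (fun a => c * f a) = c * expect μ f :=
    fun c f => by
      unfold expect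
      rw [← ENNReal.tsum_mul_left]
      exact tsum_congr fun a => by ring
  have hconst : ∀ c : ℝ≥0∞, expect μ (fun _ => c) = c := fun c => by
    unfold expect
    rw [ENNReal.tsum_mul_right, μ.tsum_coe, one_mul]
  -- All terms of `(X - Q) ^ 2 ≥ ε ^ 2 * Q ^ 2 * (1 - 1_S)` are moved to the side where they are
  -- added, so that expectations can be taken in `ℝ≥0∞`.
  have key : expect μ ((fun _ => ENNReal.ofReal (ε ^ 2 * Q ^ 2)) +
        (fun a => ENNReal.ofReal (2 * Q) * ENNReal.ofReal (X a))) ≤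
      expect μ (((fun a => ENNReal.ofReal (X a ^ 2)) + fun _ => ENNReal.ofReal (Q ^ 2)) +
        fun a => ENNReal.ofReal (ε ^ 2 * Q ^ 2) * S.indicator 1 a) := by
    refine ENNReal.tsum_le_tsum fun a => ?_
    by_cases hs : μ a = 0
    · simp [hs]
    have hx := hX a ((μ.mem_support_iff a).2 hs)
    refine mul_le_mul_right ?_ _
    simp only [Pi.add_apply]
    rw [← ENNReal.ofReal_mul (by positivity), ← ENNReal.ofReal_add (by positivity) (by positivity),
      ← ENNReal.ofReal_add (by positivity) (by positivity)]
    by_cases ha : a ∈ S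
    · simp only [ha, Set.indicator_of_mem, Pi.one_apply, mul_one]
      rw [← ENNReal.ofReal_add (by positivity) (by positivity)]
      exact ENNReal.ofReal_le_ofReal (by nlinarith [sq_nonneg (X a - Q)])
    · simp only [ha, not_false_eq_true, Set.indicator_of_notMem, mul_zero, add_zero]
      refine ENNReal.ofReal_le_ofReal ?_
      have : ε * Q ≤ |X a - Q| := by
        by_contra hc
        rw [not_le, abs_lt] at hc
        exact ha ⟨by linarith [hc.1], by linarith [hc.2]⟩
      have h4 : (ε * Q) ^ 2 ≤ |X a - Q| ^ 2 := by gcongr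
      rw [sq_abs] at h4
      nlinarith
  rw [hadd, hadd, hadd, hmul, hmul, hconst, hconst, h1, ← hPsum] at key
  have key2 := key.trans (add_le_add_left (add_le_add_left h2 _) _)
  lift P to NNReal using ne_top_of_le_ne_top ENNReal.one_ne_top hle with p
  have hp : (p : ℝ≥0∞) = ENNReal.ofReal (p : ℝ) := by simp
  -- `δ` may be negative a priori, but a variable with positive mean has a nonzero second moment.
  have hδ0 : 0 ≤ (1 + δ) * Q ^ 2 := by
    by_contra hc
    have h0 : ENNReal.ofReal ((1 + δ) * Q ^ 2) = 0 := ENNReal.ofReal_of_nonpos (by linarith)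
    rw [h0, nonpos_iff_eq_zero] at h2
    have : ENNReal.ofReal Q = 0 := by
      rw [← h1]
      unfold expect at h2 ⊢
      rw [ENNReal.tsum_eq_zero] at h2 ⊢
      intro a
      rcases mul_eq_zero.1 (h2 a) with h | h
      · simp [h]
      · rw [ENNReal.ofReal_eq_zero] at h
        have : X a = 0 := by nlinarith [sq_nonneg (X a)]
        simp [this]
    rw [ENNReal.ofReal_eq_zero] at this
    linarith
  rw [hp, ← ENNReal.ofReal_mul (by positivity), ← ENNReal.ofReal_mul (by positivity),
    ← ENNReal.ofReal_add (by positivity) (by positivity),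
    ← ENNReal.ofReal_add (by positivity) (by positivity),
    ← ENNReal.ofReal_add (by positivity) (by positivity),
    ENNReal.ofReal_le_ofReal_iff (by positivity)] at key2
  have hfin : (4 / 5 : ℝ) ≤ p := by
    have hpos : 0 < ε ^ 2 * Q ^ 2 := by positivity
    have h5 : δ * Q ^ 2 ≤ ε ^ 2 / 5 * Q ^ 2 := by gcongr
    have h6 : ε ^ 2 * Q ^ 2 * (4 / 5) ≤ ε ^ 2 * Q ^ 2 * p := by nlinarith
    exact le_of_mul_le_mul_left h6 hpos
  rw [hp]
  have h7 := ENNReal.ofReal_le_ofReal hfin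
  rwa [ENNReal.ofReal_div_of_pos (by norm_num), ENNReal.ofReal_ofNat, ENNReal.ofReal_ofNat] at h7

/-! ### Elementary properties of the partition function -/

section

variable {Ω : Type*} [Fintype Ω]

theorem partitionFunction_antitone (H : Ω → ℕ) : Antitone (partitionFunction H) := by
  intro a b hab
  unfold partitionFunction
  gcongr

theorem one_le_partitionFunction (H : Ω → ℕ) (h0 : ∃ x, H x = 0) (a : ℝ) :
    1 ≤ partitionFunction H a := by
  obtain ⟨x, hx⟩ := h0
  have := Finset.single_le_sum (f := fun x => Real.exp (-a * (H x : ℝ)))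
    (fun _ _ => (Real.exp_pos _).le) (Finset.mem_univ x)
  simpa [hx, partitionFunction] using this

end

/-! ### The product estimator along a fixed list of temperature steps -/

/-- The estimator that, for each step `(β, h)` of a fixed list, draws one sample at `β` and
multiplies the current value by `exp (-h H(x))`, whose mean is `Z(β + h) / Z(β)`. -/
noncomputable def productEstimator : List (ℝ × ℝ) → ℝ → Algorithm
  | [], p => .output p
  | s :: l, p => .sample s.1.toNNReal fun k => productEstimator l (p * Real.exp (-s.2 * k))

/-- The `k`-th moment of the product estimator started at `1`. -/
noncomputable def moment {Ω : Type*} [Fintype Ω] (H : Ω → ℕ) (k : ℕ) (l : List (ℝ × ℝ)) : ℝ :=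
  (l.map fun s => partitionFunction H (s.1 + k * s.2) / partitionFunction H s.1).prod

section

variable {Ω : Type*} [Fintype Ω]

theorem moment_append (H : Ω → ℕ) (k : ℕ) (l l' : List (ℝ × ℝ)) :
    moment H k (l ++ l') = moment H k l * moment H k l' := by
  simp [moment]

variable [Nonempty Ω]

theorem moment_nonneg (H : Ω → ℕ) (k : ℕ) (l : List (ℝ × ℝ)) : 0 ≤ moment H k l := by
  refine List.prod_nonneg fun x hx => ?_
  obtain ⟨s, -, rfl⟩ := List.mem_map.1 hx
  exact div_nonneg (partitionFunction_pos H _).le (partitionFunction_pos H _).le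

theorem mem_support_run_productEstimator (H : Ω → ℕ) (l : List (ℝ × ℝ)) (p : ℝ) (hp : 0 ≤ p) :
    ∀ r ∈ ((productEstimator l p).run H).support, 0 ≤ r.1 ∧ r.2 = l.length := by
  induction l generalizing p with
  | nil =>
    intro r hr
    simp only [productEstimator, Algorithm.run, PMF.support_pure, Set.mem_singleton_iff] at hr
    simp [hr, hp]
  | cons s l ih =>
    intro r hr
    simp only [productEstimator, Algorithm.run, PMF.mem_support_bind_iff,
      PMF.mem_support_map_iff] at hr
    obtain ⟨x, -, r', hr', rfl⟩ := hr
    obtain ⟨h1, h2⟩ := ih _ (by positivity) r' hr'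
    exact ⟨h1, by simp [h2]⟩

/-- Moments multiply along the list: averaging `exp (-k h H(x))` over a sample at `β` gives
`Z(β + k h) / Z(β)`. -/
theorem expect_productEstimator (H : Ω → ℕ) (k : ℕ) (l : List (ℝ × ℝ)) (hl : ∀ s ∈ l, 0 ≤ s.1)
    (p : ℝ) (hp : 0 ≤ p) :
    expect ((productEstimator l p).run H) (fun r => ENNReal.ofReal (r.1 ^ k)) =
      ENNReal.ofReal (p ^ k * moment H k l) := by
  induction l generalizing p with
  | nil => simp [productEstimator, Algorithm.run, expect_pure, moment]
  | cons s l ih =>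
    have hs : 0 ≤ s.1 := hl s (by simp)
    have hZ := partitionFunction_pos H s.1
    have hM := moment_nonneg H k l
    simp only [productEstimator, Algorithm.run, expect_bind, expect_map, Function.comp_def]
    have ih' := fun x => ih (fun s' h => hl s' (by simp [h]))
      (p * Real.exp (-s.2 * (H x : ℕ))) (by positivity)
    simp only [ih']
    unfold expect gibbs
    rw [tsum_fintype]
    simp only [PMF.ofFintype_apply, Real.coe_toNNReal _ hs]
    have hterm : ∀ x, ENNReal.ofReal (Real.exp (-s.1 * H x) / partitionFunction H s.1) *
        ENNReal.ofReal ((p * Real.exp (-s.2 * H x)) ^ k * moment H k l) =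
        ENNReal.ofReal (Real.exp (-(s.1 + k * s.2) * H x) *
          (p ^ k * moment H k l / partitionFunction H s.1)) := fun x => by
      rw [← ENNReal.ofReal_mul (by positivity), mul_pow, ← Real.exp_nat_mul,
        show -(s.1 + k * s.2) * (H x : ℝ) = -s.1 * H x + k * (-s.2 * H x) by ring, Real.exp_add]
      congr 1
      ring
    simp only [hterm]
    rw [← ENNReal.ofReal_sum_of_nonneg fun x _ => by positivity, ← Finset.sum_mul]
    congr 1
    simp only [moment, List.map_cons, List.prod_cons]
    change partitionFunction H _ * _ = _
    ring

/-! ### Mean energy and the decay of the partition function -/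

/-- The mean energy of the Gibbs distribution at inverse temperature `β`, which is
`-(log Z)' (β)`. -/
noncomputable def meanEnergy (H : Ω → ℕ) (β : ℝ) : ℝ :=
  (∑ x, (H x : ℝ) * Real.exp (-β * H x)) / partitionFunction H β

/-- Jensen's inequality in the form `log Z(b) ≥ log Z(a) + (b - a) (log Z)' (a)`. -/
theorem mul_exp_meanEnergy_le (H : Ω → ℕ) (a b : ℝ) :
    partitionFunction H a * Real.exp (-(b - a) * meanEnergy H a) ≤ partitionFunction H b := by
  have hZ := partitionFunction_pos H a
  set D := meanEnergy H a with hD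
  have hDZ : ∑ x, (H x : ℝ) * Real.exp (-a * H x) = D * partitionFunction H a := by
    rw [hD, meanEnergy, div_mul_cancel₀ _ hZ.ne']
  -- The tangent line of the exponential at `-(b - a) * D` bounds every Boltzmann weight.
  have hx : ∀ x, Real.exp (-a * H x) * (Real.exp (-(b - a) * D) * (1 - (b - a) * (H x - D))) ≤
      Real.exp (-b * H x) := fun x => by
    rw [show -b * (H x : ℝ) = -a * H x + (-(b - a) * D + -(b - a) * (H x - D)) by ring,
      Real.exp_add, Real.exp_add]
    have := Real.add_one_le_exp (-(b - a) * (H x - D))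
    gcongr
    linarith
  have hsum := Finset.sum_le_sum fun x (_ : x ∈ Finset.univ) => hx x
  refine le_trans (le_of_eq ?_) hsum
  have hsplit : ∀ x, Real.exp (-a * H x) * (Real.exp (-(b - a) * D) * (1 - (b - a) * (H x - D))) =
      Real.exp (-(b - a) * D) * ((1 + (b - a) * D) * Real.exp (-a * H x) -
        (b - a) * (H x * Real.exp (-a * H x))) := fun x => by ring
  simp only [hsplit]
  rw [← Finset.mul_sum, Finset.sum_sub_distrib, ← Finset.mul_sum, ← Finset.mul_sum, hDZ]
  change _ = Real.exp (-(b - a) * D) * ((1 + (b - a) * D) * partitionFunction H a - _)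
  ring

theorem meanEnergy_nonneg (H : Ω → ℕ) (a : ℝ) : 0 ≤ meanEnergy H a :=
  div_nonneg (Finset.sum_nonneg fun x _ => by positivity) (partitionFunction_pos H a).le

theorem meanEnergy_le (H : Ω → ℕ) {n : ℕ} (hn : ∀ x, H x ≤ n) (a : ℝ) : meanEnergy H a ≤ n := by
  rw [meanEnergy, div_le_iff₀ (partitionFunction_pos H a), partitionFunction, Finset.mul_sum]
  gcongr with x
  exact hn x

/-- The tangent of `log Z` at `a` lies below `log Z` at `0`, where its value is `log |Ω|`. -/
theorem mul_meanEnergy_le (H : Ω → ℕ) (h0 : ∃ x, H x = 0) (a : ℝ) :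
    a * meanEnergy H a ≤ Real.log (Fintype.card Ω) := by
  have h := mul_exp_meanEnergy_le H a 0
  have h1 := one_le_partitionFunction H h0 a
  have hc : partitionFunction H 0 = Fintype.card Ω := by simp [partitionFunction]
  rw [Real.le_log_iff_exp_le (by exact_mod_cast Fintype.card_pos), ← hc]
  refine le_trans ?_ h
  rw [show -(0 - a) * meanEnergy H a = a * meanEnergy H a by ring]
  exact le_mul_of_one_le_left (Real.exp_pos _).le h1

theorem meanEnergy_le_exp (H : Ω → ℕ) (h0 : ∃ x, H x = 0) {a : ℝ} (ha : 1 ≤ a) :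
    meanEnergy H a ≤ Real.exp (Real.log (Fintype.card Ω) - a) := by
  have hterm : ∀ x, (H x : ℝ) * Real.exp (-a * H x) ≤ Real.exp (-a) := fun x => by
    rcases Nat.eq_zero_or_pos (H x) with h | h
    · simp [h, Real.exp_nonneg]
    have h1 : (1 : ℝ) ≤ H x := by exact_mod_cast h
    have h2 : (H x : ℝ) ≤ Real.exp (H x - 1) := by
      have := Real.add_one_le_exp ((H x : ℝ) - 1)
      linarith
    calc (H x : ℝ) * Real.exp (-a * H x) ≤ Real.exp (H x - 1) * Real.exp (-a * H x) := by gcongr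
      _ = Real.exp ((H x - 1) + -a * H x) := (Real.exp_add _ _).symm
      _ ≤ Real.exp (-a) := Real.exp_le_exp.2 (by nlinarith)
  have hsum := Finset.sum_le_sum fun x (_ : x ∈ Finset.univ) => hterm x
  rw [Real.exp_sub, Real.exp_log (by exact_mod_cast Fintype.card_pos), div_eq_mul_inv,
    ← Real.exp_neg]
  simp only [Finset.sum_const, Finset.card_univ, nsmul_eq_mul] at hsum
  exact (div_le_self (Finset.sum_nonneg fun x _ => by positivity)
    (one_le_partitionFunction H h0 a)).trans hsum

/-- The weights of the excited states at `a` add up to at most `|Ω| exp (-a)`, and `Z(b) ≥ 1`. This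
bounds the loss of a single step, however long. -/
theorem partitionFunction_le_mul_exp_exp (H : Ω → ℕ) (h0 : ∃ x, H x = 0) {a : ℝ} (ha : 0 ≤ a)
    (b : ℝ) : partitionFunction H a ≤
      partitionFunction H b * Real.exp (Real.exp (Real.log (Fintype.card Ω) - a)) := by
  have hterm : ∀ x, Real.exp (-a * H x) - Real.exp (-b * H x) ≤ Real.exp (-a) := fun x => by
    rcases Nat.eq_zero_or_pos (H x) with h | h
    · simp [h, Real.exp_nonneg]
    have h1 : (1 : ℝ) ≤ H x := by exact_mod_cast h
    have h2 : Real.exp (-a * H x) ≤ Real.exp (-a) := Real.exp_le_exp.2 (by nlinarith)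
    linarith [Real.exp_pos (-b * H x)]
  have hsum := Finset.sum_le_sum fun x (_ : x ∈ Finset.univ) => hterm x
  simp only [Finset.sum_sub_distrib, Finset.sum_const, Finset.card_univ, nsmul_eq_mul] at hsum
  change partitionFunction H a - partitionFunction H b ≤ _ at hsum
  have he : Real.exp (Real.log (Fintype.card Ω) - a) = Fintype.card Ω * Real.exp (-a) := by
    rw [Real.exp_sub, Real.exp_log (by exact_mod_cast Fintype.card_pos), div_eq_mul_inv,
      ← Real.exp_neg]
  rw [← he] at hsum
  have h1 := one_le_partitionFunction H h0 b
  have h2 := Real.add_one_le_exp (Real.exp (Real.log (Fintype.card Ω) - a))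
  have h3 := Real.exp_pos (Real.log (Fintype.card Ω) - a)
  nlinarith

/-! ### Temperature schedules -/

/-- The list `l` of temperature steps leads from `a` to `b`, starting each step at a nonnegative
inverse temperature, and the second moment of its product estimator exceeds the square of the
mean by a factor at most `exp κ`. -/
structure Controlled (H : Ω → ℕ) (l : List (ℝ × ℝ)) (a b κ : ℝ) : Prop where
  nonneg : ∀ s ∈ l, 0 ≤ s.1
  mean : moment H 1 l = partitionFunction H b / partitionFunction H a
  second : moment H 2 l ≤ (partitionFunction H b / partitionFunction H a) ^ 2 * Real.exp κ

theorem Controlled.nil (H : Ω → ℕ) (a : ℝ) : Controlled H [] a a 0 where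
  nonneg := by simp
  mean := by simp [moment, (partitionFunction_pos H a).ne']
  second := by simp [moment, (partitionFunction_pos H a).ne']

theorem Controlled.append {H : Ω → ℕ} {l l' : List (ℝ × ℝ)} {a b c κ κ' : ℝ}
    (h : Controlled H l a b κ) (h' : Controlled H l' b c κ') :
    Controlled H (l ++ l') a c (κ + κ') := by
  have ha := partitionFunction_pos H a
  have hb := partitionFunction_pos H b
  have hc := partitionFunction_pos H c
  have hac : partitionFunction H c / partitionFunction H a =
      partitionFunction H b / partitionFunction H a *
        (partitionFunction H c / partitionFunction H b) := by
    field_simp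
  refine ⟨fun s hs => ?_, ?_, ?_⟩
  · rcases List.mem_append.1 hs with hs | hs
    · exact h.nonneg s hs
    · exact h'.nonneg s hs
  · rw [moment_append, h.mean, h'.mean, hac]
  · rw [moment_append, hac]
    calc _ ≤ _ := mul_le_mul h.second h'.second (moment_nonneg H 2 l') (by positivity)
      _ = _ := by rw [Real.exp_add]; ring

theorem Controlled.flatMap_range {H : Ω → ℕ} (B : ℕ → List (ℝ × ℝ)) (T κ : ℕ → ℝ) (M : ℕ)
    (h : ∀ j < M, Controlled H (B j) (T j) (T (j + 1)) (κ j)) :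
    Controlled H ((List.range M).flatMap B) (T 0) (T M) (∑ j ∈ Finset.range M, κ j) := by
  induction M with
  | zero => simpa using Controlled.nil H (T 0)
  | succ M ih =>
    rw [List.range_succ, List.flatMap_append, Finset.sum_range_succ]
    refine (ih fun j hj => h j (by omega)).append ?_
    simpa using h M (by omega)

/-- `N` equal temperature steps from `a` to `b`. -/
noncomputable def equalSteps (a b : ℝ) (N : ℕ) : List (ℝ × ℝ) :=
  (List.range N).map fun i : ℕ => (a + i * ((b - a) / N), (b - a) / N)

/-- The relative second moment of equal steps telescopes to
`Z(a) Z(b + h) / (Z(b) Z(a + h))`, where `h` is the step size. -/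
theorem equalSteps_controlled (H : Ω → ℕ) {a b κ : ℝ} (ha : 0 ≤ a) (hab : a ≤ b) {N : ℕ}
    (hN : 0 < N)
    (hκ : partitionFunction H a ≤ partitionFunction H (a + (b - a) / N) * Real.exp κ) :
    Controlled H (equalSteps a b N) a b κ := by
  have hN' : (0 : ℝ) < N := by exact_mod_cast hN
  set h := (b - a) / N with hh
  have h0 : 0 ≤ h := div_nonneg (by linarith) hN'.le
  set z : ℕ → ℝ := fun i => partitionFunction H (a + i * h) with hz
  have zpos : ∀ i, 0 < z i := fun i => partitionFunction_pos H _
  have hmom : ∀ k, moment H k (equalSteps a b N) = ∏ i ∈ Finset.range N, z (i + k) / z i := by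
    intro k
    have hlist : ∀ (f : ℕ → ℝ) (M : ℕ), ((List.range M).map f).prod = ∏ i ∈ Finset.range M, f i :=
      fun _ _ => rfl
    rw [moment, equalSteps, List.map_map, hlist]
    refine Finset.prod_congr rfl fun i _ => ?_
    simp only [Function.comp_apply, hz]
    congr 2
    push_cast
    ring
  have tel : ∀ (g : ℕ → ℝ), (∀ i, 0 < g i) → ∀ M,
      ∏ i ∈ Finset.range M, g (i + 1) / g i = g M / g 0 := by
    intro g hg M
    induction M with
    | zero => simp [(hg 0).ne']
    | succ M ih =>
      rw [Finset.prod_range_succ, ih]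
      have := (hg M).ne'
      field_simp
  have hz0 : z 0 = partitionFunction H a := by simp [hz]
  have hz1 : z 1 = partitionFunction H (a + h) := by simp [hz]
  have hzN : z N = partitionFunction H b := by
    simp only [hz, hh]
    congr 1
    field_simp
    ring
  refine ⟨fun s hs => ?_, ?_, ?_⟩
  · obtain ⟨i, -, rfl⟩ := List.mem_map.1 hs
    change 0 ≤ a + i * h
    positivity
  · rw [hmom, tel z zpos, hzN, hz0]
  · have hsplit : ∀ i, z (i + 2) / z i = z (i + 1) / z i * (z (i + 1 + 1) / z (i + 1)) := fun i => by
      have := (zpos (i + 1)).ne'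
      have := (zpos i).ne'
      field_simp
    rw [hmom]
    simp only [hsplit]
    rw [Finset.prod_mul_distrib, tel z zpos, tel (fun i => z (i + 1)) fun i => zpos _]
    rw [← hz0, ← hz1] at hκ
    rw [← hzN, ← hz0]
    -- The other factor `Z(b + h) / Z(b)` is at most `1`.
    have hanti : z (N + 1) ≤ z N := partitionFunction_antitone H (by push_cast; nlinarith)
    have p0 := zpos 0
    have p1 := zpos 1
    have pN := zpos N
    have hinv : (z 1)⁻¹ ≤ (z 0)⁻¹ * Real.exp κ := by
      rw [inv_mul_eq_div, inv_le_comm₀ p1 (by positivity), inv_div, div_le_iff₀ (Real.exp_pos _)]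
      exact hκ
    calc z N / z 0 * (z (N + 1) / z (0 + 1)) ≤ z N / z 0 * (z N * ((z 0)⁻¹ * Real.exp κ)) := by
          rw [zero_add, div_eq_mul_inv (z (N + 1))]
          gcongr
      _ = (z N / z 0) ^ 2 * Real.exp κ := by ring

/-- `N` equal steps from `s` to `t`, after both have been clamped to `[lo, hi]`. -/
noncomputable def clampedSteps (lo hi s t : ℝ) (N : ℕ) : List (ℝ × ℝ) :=
  equalSteps (max lo (min s hi)) (max lo (min t hi)) N

theorem length_clampedSteps (lo hi s t : ℝ) (N : ℕ) : (clampedSteps lo hi s t N).length = N := by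
  simp [clampedSteps, equalSteps]

/-- When `s` exceeds `hi`, both clamped ends are `hi`; otherwise clamping moves `s` up and does not
lengthen the interval. -/
theorem clampedSteps_controlled_of_meanEnergy_le (H : Ω → ℕ) {lo hi s t D : ℝ} (hlo : 0 ≤ lo)
    (hhi : lo ≤ hi) (hst : s ≤ t) {N : ℕ} (hN : 0 < N) (hD0 : 0 ≤ D)
    (hD : ∀ a, 0 ≤ a → s ≤ a → meanEnergy H a ≤ D) :
    Controlled H (clampedSteps lo hi s t N) (max lo (min s hi)) (max lo (min t hi))
      ((t - s) / N * D) := by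
  have hN' : (0 : ℝ) < N := by exact_mod_cast hN
  have hab : max lo (min s hi) ≤ max lo (min t hi) := by gcongr
  have ha0 : 0 ≤ max lo (min s hi) := hlo.trans (le_max_left _ _)
  have hlip : max lo (min t hi) - max lo (min s hi) ≤ t - s := by
    rcases max_cases lo (min t hi) with h | h <;> rcases max_cases lo (min s hi) with h' | h' <;>
    rcases min_cases t hi with h2 | h2 <;> rcases min_cases s hi with h3 | h3 <;> linarith
  refine equalSteps_controlled H ha0 hab hN ?_
  set a := max lo (min s hi) with ha
  set b := max lo (min t hi) with hb
  have hJ := mul_exp_meanEnergy_le H a (a + (b - a) / N)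
  have hκ : (b - a) / N * meanEnergy H a ≤ (t - s) / N * D := by
    rcases le_or_gt s hi with h | h
    · have : s ≤ a := by rw [ha, min_eq_left h]; exact le_max_right _ _
      calc _ ≤ (b - a) / N * D := by
            refine mul_le_mul_of_nonneg_left (hD a ha0 this) (div_nonneg (by linarith) hN'.le)
        _ ≤ _ := by gcongr
    · have h1 : a = hi := by rw [ha, min_eq_right h.le, max_eq_right hhi]
      have h2 : b = hi := by rw [hb, min_eq_right (h.le.trans hst), max_eq_right hhi]
      rw [h1, h2, sub_self, zero_div, zero_mul]
      exact mul_nonneg (div_nonneg (by linarith) hN'.le) hD0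
  have hJ' := mul_le_mul_of_nonneg_right hJ (Real.exp_pos ((t - s) / N * D)).le
  refine le_trans ?_ hJ'
  rw [mul_assoc, ← Real.exp_add]
  refine le_mul_of_one_le_right (partitionFunction_pos H a).le (Real.one_le_exp ?_)
  linarith

/-- A single step to `hi` is cheap once `s` is well beyond `log |Ω|`. -/
theorem clampedSteps_one_controlled (H : Ω → ℕ) (h0 : ∃ x, H x = 0) {lo hi s : ℝ}
    (hlo : 0 ≤ lo) (hhi : lo ≤ hi) :
    Controlled H (clampedSteps lo hi s hi 1) (max lo (min s hi)) hi
      (Real.exp (Real.log (Fintype.card Ω) - s)) := by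
  have hb : max lo (min hi hi) = hi := by rw [min_self, max_eq_right hhi]
  have hab : max lo (min s hi) ≤ hi := max_le hhi (min_le_right _ _)
  have ha0 : 0 ≤ max lo (min s hi) := hlo.trans (le_max_left _ _)
  unfold clampedSteps
  rw [hb]
  refine equalSteps_controlled H ha0 hab one_pos ?_
  rcases le_or_gt s hi with h | h
  · refine (partitionFunction_le_mul_exp_exp H h0 ha0
      (max lo (min s hi) + (hi - max lo (min s hi)) / (1 : ℕ))).trans ?_
    refine mul_le_mul_of_nonneg_left ?_ (partitionFunction_pos H _).le
    rw [min_eq_left h]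
    gcongr
    exact le_max_right _ _
  · rw [min_eq_right h.le, max_eq_right hhi, sub_self, zero_div, add_zero]
    exact le_mul_of_one_le_right (partitionFunction_pos H _).le
      (Real.one_le_exp (Real.exp_pos _).le)

/-- The temperature steps of the algorithm, as a function of `q = log |Ω|`, the maximal energy `n`
and accuracy parameters `J`, `N`, `M`. The breakpoints are `(2 ^ i - 1) q / n` for `i ≤ J`, with
`N` steps between any two, then `M` intervals of length `2` with `N / 2 ^ j + 1` steps in the
`j`-th, and one final step to `hi`. All breakpoints are clamped to `[lo, hi]`. -/
noncomputable def annealingSchedule (q : ℝ) (n J N M : ℕ) (lo hi : ℝ) : List (ℝ × ℝ) :=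
  (List.range J).flatMap (fun i : ℕ =>
      clampedSteps lo hi ((2 ^ i - 1) * (q / n)) ((2 ^ (i + 1) - 1) * (q / n)) N) ++
    (List.range M).flatMap (fun j : ℕ =>
      clampedSteps lo hi ((2 ^ J - 1) * (q / n) + 2 * j)
        ((2 ^ J - 1) * (q / n) + 2 * (j + 1 : ℕ)) (N / 2 ^ j + 1)) ++
    clampedSteps lo hi ((2 ^ J - 1) * (q / n) + 2 * M) hi 1

theorem length_annealingSchedule_le (q : ℝ) (n J N M : ℕ) (lo hi : ℝ) :
    ((annealingSchedule q n J N M lo hi).length : ℝ) ≤ J * N + 2 * N + M + 1 := by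
  have hflat : ∀ (B : ℕ → List (ℝ × ℝ)) (K : ℕ),
      ((List.range K).flatMap B).length = ∑ j ∈ Finset.range K, (B j).length := by
    intro B K
    rw [List.length_flatMap]
    rfl
  simp only [annealingSchedule, List.length_append, hflat, length_clampedSteps, Finset.sum_const,
    Finset.card_range, smul_eq_mul, Finset.sum_add_distrib, mul_one]
  have hgeom : ((∑ j ∈ Finset.range M, N / 2 ^ j : ℕ) : ℝ) ≤ 2 * N := by
    push_cast
    calc _ ≤ ∑ j ∈ Finset.range M, (N : ℝ) * (1 / 2) ^ j := by
          refine Finset.sum_le_sum fun j _ => ?_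
          refine Nat.cast_div_le.trans (le_of_eq ?_)
          rw [one_div, inv_pow, div_eq_mul_inv]
          push_cast
          rfl
      _ = N * ∑ j ∈ Finset.range M, (1 / 2 : ℝ) ^ j := (Finset.mul_sum _ _ _).symm
      _ ≤ N * 2 := by gcongr; exact sum_geometric_two_le M
      _ = 2 * N := mul_comm _ _
  push_cast at hgeom ⊢
  linarith

/-- Each interval of the geometric part has length times mean energy at most `2 q`. The geometric
part ends beyond `q`, from where the mean energy is exponentially small. -/
theorem annealingSchedule_controlled (H : Ω → ℕ) {q : ℝ} {n J N : ℕ} (M : ℕ) {lo hi : ℝ}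
    (hn : ∀ x, H x ≤ n) (h0 : ∃ x, H x = 0) (hq : q = Real.log (Fintype.card Ω)) (hq1 : 1 ≤ q)
    (hn0 : 0 < n) (hJ : n < 2 ^ J) (hN : 0 < N) (hlo : 0 ≤ lo) (hhi : lo ≤ hi) :
    Controlled H (annealingSchedule q n J N M lo hi) lo hi
      (2 * q * J / N + 4 / N + Real.exp (-(2 * M))) := by
  have hn' : (0 : ℝ) < n := by exact_mod_cast hn0
  have hN' : (0 : ℝ) < N := by exact_mod_cast hN
  set r := q / n with hr
  have hr0 : 0 < r := by positivity
  set S := ((2 : ℝ) ^ J - 1) * r with hS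
  have hSq : q ≤ S := by
    have : (n : ℝ) + 1 ≤ 2 ^ J := by exact_mod_cast hJ
    calc q = n * r := by rw [hr]; field_simp
      _ ≤ S := by rw [hS]; gcongr; linarith
  have h1 := Controlled.flatMap_range (H := H)
    (fun i => clampedSteps lo hi ((2 ^ i - 1) * r) ((2 ^ (i + 1) - 1) * r) N)
    (fun i => max lo (min ((2 ^ i - 1) * r) hi)) (fun _ => 2 * q / N) J (fun i _ => by
      have hp : (0 : ℝ) < 2 ^ i := by positivity
      have hp1 : (1 : ℝ) ≤ 2 ^ i := one_le_pow₀ (by norm_num)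
      have hc := clampedSteps_controlled_of_meanEnergy_le H (s := (2 ^ i - 1) * r)
        (t := (2 ^ (i + 1) - 1) * r) (D := 2 * q / (2 ^ i * r)) hlo hhi
        (by gcongr <;> norm_num) hN (by positivity) (fun a _ hsa => by
          rw [le_div_iff₀ (by positivity)]
          have e1 : a * meanEnergy H a ≤ q := hq ▸ mul_meanEnergy_le H h0 a
          have e2 : r * meanEnergy H a ≤ q := by
            calc r * meanEnergy H a ≤ r * n := by gcongr; exact meanEnergy_le H hn a
              _ = q := by rw [hr]; field_simp
          have e3 : 2 ^ i * r ≤ a + r := by linarith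
          nlinarith [mul_le_mul_of_nonneg_left e3 (meanEnergy_nonneg H a)])
      convert hc using 1
      rw [pow_succ]
      field_simp
      ring)
  have h2 := Controlled.flatMap_range (H := H)
    (fun j => clampedSteps lo hi (S + 2 * j) (S + 2 * (j + 1 : ℕ)) (N / 2 ^ j + 1))
    (fun j => max lo (min (S + 2 * j) hi))
    (fun j => 2 / (N / 2 ^ j + 1 : ℕ) * Real.exp (-(2 * j))) M (fun j _ => by
      have hc := clampedSteps_controlled_of_meanEnergy_le H (s := S + 2 * j)
        (t := S + 2 * (j + 1 : ℕ)) (D := Real.exp (-(2 * j))) (N := N / 2 ^ j + 1) hlo hhi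
        (by push_cast; linarith) (Nat.succ_pos _) (Real.exp_pos _).le (fun a _ hsa => by
          have hj : (0 : ℝ) ≤ j := by positivity
          refine (meanEnergy_le_exp H h0 (by linarith)).trans (Real.exp_le_exp.2 ?_)
          rw [← hq]
          linarith)
      convert hc using 2
      push_cast
      ring)
  have h3 := clampedSteps_one_controlled H h0 (s := S + 2 * M) hlo hhi
  have hlo0 : max lo (min ((2 ^ 0 - 1) * r) hi) = lo := by
    rw [pow_zero, sub_self, zero_mul, min_eq_left (hlo.trans hhi), max_eq_left hlo]
  simp only [hlo0, Nat.cast_zero, mul_zero, add_zero] at h1 h2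
  have h := (h1.append h2).append h3
  refine ⟨h.nonneg, h.mean, h.second.trans ?_⟩
  refine mul_le_mul_of_nonneg_left (Real.exp_le_exp.2 ?_) (sq_nonneg _)
  refine add_le_add (add_le_add ?_ ?_) (Real.exp_le_exp.2 (by rw [← hq]; linarith))
  · rw [Finset.sum_const, Finset.card_range, nsmul_eq_mul]
    exact le_of_eq (by ring)
  · have hexp : Real.exp (-2) ≤ 1 / 4 := by
      rw [Real.exp_neg, inv_le_comm₀ (Real.exp_pos _) (by norm_num)]
      have h21 : Real.exp 2 = Real.exp 1 * Real.exp 1 := by rw [← Real.exp_add]; norm_num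
      nlinarith [Real.exp_one_gt_d9]
    calc _ ≤ ∑ j ∈ Finset.range M, 2 / (N : ℝ) * (1 / 2) ^ j := by
          refine Finset.sum_le_sum fun j _ => ?_
          have hp : (0 : ℝ) < 2 ^ j := by positivity
          have e1 : (N : ℝ) / 2 ^ j ≤ (N / 2 ^ j + 1 : ℕ) := by
            rw [div_le_iff₀ hp]
            exact_mod_cast (Nat.lt_mul_of_div_lt (Nat.lt_succ_self _) (by positivity)).le
          have e2 : Real.exp (-(2 * j)) ≤ (1 / 4) ^ j := by
            rw [show -(2 * (j : ℝ)) = j * (-2) by ring, Real.exp_nat_mul]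
            gcongr
          calc _ ≤ 2 / ((N : ℝ) / 2 ^ j) * (1 / 4) ^ j := by gcongr
            _ = 2 / (N : ℝ) * (2 ^ j * (1 / 4) ^ j) := by field_simp
            _ = _ := by rw [← mul_pow]; norm_num
      _ = 2 / (N : ℝ) * ∑ j ∈ Finset.range M, (1 / 2 : ℝ) ^ j := (Finset.mul_sum _ _ _).symm
      _ ≤ 2 / (N : ℝ) * 2 := by gcongr; exact sum_geometric_two_le M
      _ = 4 / N := by ring

end

/-! ### The algorithm -/

/-- The product estimator along the annealing schedule, with parameters chosen so that its relative
variance is at most `ε ^ 2 / 5`. -/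
noncomputable def gibbsEstimator (n card : ℕ) (lo hi ε : ℝ) : Algorithm :=
  productEstimator (annealingSchedule (Real.log card) n (Nat.log 2 n + 1)
    ⌈96 * Real.log card * Real.log n / ε ^ 2⌉₊ ⌈6 / ε ^ 2⌉₊ lo hi) 1

theorem natLog_two_add_one_le {n : ℕ} (hn : 1 ≤ Real.log n) :
    ((Nat.log 2 n + 1 : ℕ) : ℝ) ≤ 3 * Real.log n := by
  have hn0 : n ≠ 0 := by
    rintro rfl
    norm_num at hn
  have h1 : ((2 ^ Nat.log 2 n : ℕ) : ℝ) ≤ n := by exact_mod_cast Nat.pow_log_le_self 2 hn0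
  have h2 := Real.log_le_log (by positivity) h1
  rw [Nat.cast_pow, Real.log_pow] at h2
  have h3 := Real.log_two_gt_d9
  have h4 : (0 : ℝ) ≤ Nat.log 2 n := by positivity
  push_cast at h2 ⊢
  nlinarith

/-- The relative variance of the estimator is at most `ε ^ 2 / 5`. -/
theorem gibbsEstimator_accuracy {Ω : Type*} [Fintype Ω] [Nonempty Ω] (H : Ω → ℕ) {n : ℕ}
    {lo hi ε : ℝ} (hn : ∀ x, H x ≤ n) (h0 : ∃ x, H x = 0) (hL : 1 ≤ Real.log n)
    (hq : 2 ≤ Real.log (Fintype.card Ω)) (hlo : 0 ≤ lo) (hhi : lo ≤ hi) (hε : 0 < ε)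
    (hε1 : ε < 1) :
    4 / 5 ≤ ((gibbsEstimator n (Fintype.card Ω) lo hi ε).run H).toOuterMeasure
      {p : ℝ × ℕ | (1 - ε) * (partitionFunction H hi / partitionFunction H lo) ≤ p.1 ∧
        p.1 ≤ (1 + ε) * (partitionFunction H hi / partitionFunction H lo)} := by
  unfold gibbsEstimator
  set q := Real.log (Fintype.card Ω) with hqdef
  set L := Real.log n with hLdef
  set N := ⌈96 * q * L / ε ^ 2⌉₊ with hNdef
  set M := ⌈6 / ε ^ 2⌉₊ with hMdef
  have hε2 : 0 < ε ^ 2 := by positivity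
  have hε21 : ε ^ 2 ≤ 1 := pow_le_one₀ hε.le hε1.le
  have hqL : 2 ≤ q * L := by nlinarith
  have hNle : 96 * q * L / ε ^ 2 ≤ N := Nat.le_ceil _
  have hMle : 6 / ε ^ 2 ≤ M := Nat.le_ceil _
  have hN' : (0 : ℝ) < N := lt_of_lt_of_le (by positivity) hNle
  have hN : 0 < N := by exact_mod_cast hN'
  have hn0 : 0 < n := by
    rcases Nat.eq_zero_or_pos n with h | h
    · norm_num [hLdef, h] at hL
    · exact h
  have hJ := natLog_two_add_one_le hL
  set J := Nat.log 2 n + 1 with hJdef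
  have hc := annealingSchedule_controlled H M hn h0 hqdef (by linarith) hn0
    (Nat.lt_pow_succ_log_self one_lt_two n) hN hlo hhi
  set K := 2 * q * J / N + 4 / N + Real.exp (-(2 * M)) with hK
  have hKle : K ≤ ε ^ 2 / 6 := by
    have e1 : 2 * q * J / N + 4 / N ≤ ε ^ 2 / 12 := by
      rw [← add_div, div_le_iff₀ hN']
      rw [div_le_iff₀ hε2] at hNle
      nlinarith
    have e2 : Real.exp (-(2 * M)) ≤ ε ^ 2 / 12 := by
      rw [Real.exp_neg, inv_le_comm₀ (Real.exp_pos _) (by positivity), inv_div]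
      have e3 := Real.add_one_le_exp (2 * (M : ℝ))
      have e4 : 12 / ε ^ 2 = 2 * (6 / ε ^ 2) := by ring
      linarith
    linarith
  have hK0 : 0 ≤ K := by positivity
  refine relative_error_le _ Prod.fst
    (fun r hr => (mem_support_run_productEstimator H _ 1 zero_le_one r hr).1)
    (div_pos (partitionFunction_pos H hi) (partitionFunction_pos H lo)) hε
    (δ := Real.exp K - 1) ?_ ?_ ?_
  · have := Real.abs_exp_sub_one_sub_id_le (x := K) (by rw [abs_of_nonneg hK0]; linarith)
    have := (abs_le.1 this).2
    nlinarith
  · have := expect_productEstimator H 1 _ hc.nonneg 1 zero_le_one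
    simpa only [pow_one, one_mul, hc.mean] using this
  · rw [expect_productEstimator H 2 _ hc.nonneg 1 zero_le_one]
    refine ENNReal.ofReal_le_ofReal ?_
    rw [one_pow, one_mul, add_sub_cancel, mul_comm]
    exact hc.second

/-- The cost does not depend on the samples drawn: it is the length of the schedule. -/
theorem gibbsEstimator_cost {Ω : Type*} [Fintype Ω] [Nonempty Ω] (H : Ω → ℕ) {n : ℕ}
    {lo hi ε : ℝ} (hL : 1 ≤ Real.log n) (hq : 2 ≤ Real.log (Fintype.card Ω)) (hε : 0 < ε)
    (hε1 : ε < 1) :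
    ∀ p ∈ ((gibbsEstimator n (Fintype.card Ω) lo hi ε).run H).support,
      (p.2 : ℝ) ≤ 500 * (Real.log (Fintype.card Ω) * Real.log n ^ 2 * (ε ^ 2)⁻¹) := by
  intro p hp
  rw [(mem_support_run_productEstimator H _ 1 zero_le_one p hp).2]
  refine (length_annealingSchedule_le _ _ _ _ _ _ _).trans ?_
  have hJ := natLog_two_add_one_le hL
  set J := Nat.log 2 n + 1
  set q := Real.log (Fintype.card Ω)
  set L := Real.log n
  set u := (ε ^ 2)⁻¹ with hu
  have hu1 : 1 ≤ u := (one_le_inv₀ (by positivity)).2 (pow_le_one₀ hε.le hε1.le)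
  have hN := (Nat.ceil_lt_add_one (a := 96 * q * L / ε ^ 2) (by positivity)).le
  have hM := (Nat.ceil_lt_add_one (a := 6 / ε ^ 2) (by positivity)).le
  set N := ⌈96 * q * L / ε ^ 2⌉₊
  set M := ⌈6 / ε ^ 2⌉₊
  rw [div_eq_mul_inv, ← hu] at hN hM
  have hqL : 2 ≤ q * L := by nlinarith
  have hqLu : 2 * u ≤ q * L * u := by gcongr
  have hN2 : (N : ℝ) ≤ 97 * (q * L * u) := by linarith
  have hqLLu : q * L * u ≤ q * L * u * L := le_mul_of_one_le_right (by positivity) hL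
  have hJN : (J : ℝ) * N ≤ 3 * L * (97 * (q * L * u)) := by gcongr
  nlinarith

end GibbsSampling

theorem theorem2p10 :
    -- The algorithm is given `n`, `|Ω|`, `βmin`, `βmax`, `ε`, but neither `Ω` nor `H`.
    ∃ A : (n card : ℕ) → (βmin βmax ε : ℝ) → GibbsSampling.Algorithm,
    ∃ (C : ℝ) (k : ℕ),
    ∀ (Ω : Type*) [Fintype Ω] [Nonempty Ω] (n : ℕ) (H : Ω → ℕ) (βmin βmax ε q Q : ℝ),
      (∀ x, H x ≤ n) →
      (∃ x, H x = 0) →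
      q = Real.log (Fintype.card Ω) →
      Q = GibbsSampling.partitionFunction H βmax / GibbsSampling.partitionFunction H βmin →
      1 ≤ Real.log n →
      1 ≤ Real.log q →
      Real.log n ≤ Fintype.card Ω →
      0 ≤ βmin →
      βmin < βmax →
      0 < ε →
      ε < 1 →
      -- the number of Gibbs samples, in every possible run
      (∀ p ∈ ((A n (Fintype.card Ω) βmin βmax ε).run H).support,
        (p.2 : ℝ) ≤ 5 * 10 ^ 5 * q * Real.log n ^ 2 * (Real.log q + Real.log n) ^ 2
            + 7 * 10 ^ 9 * q * Real.log n ^ 2 * (ε ^ 2)⁻¹ ∧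
        (p.2 : ℝ) ≤ C * (q * (ε ^ 2)⁻¹) * (Real.log q + Real.log n) ^ k) ∧
      -- the output is an `ε`-relative estimate of `Q` with probability at least `4 / 5`
      4 / 5 ≤ ((A n (Fintype.card Ω) βmin βmax ε).run H).toOuterMeasure
        {p : ℝ × ℕ | (1 - ε) * Q ≤ p.1 ∧ p.1 ≤ (1 + ε) * Q} := by
  refine ⟨GibbsSampling.gibbsEstimator, 500, 2, ?_⟩
  intro Ω _ _ n H βmin βmax ε q Q hn h0 hq hQ hL hlq _ hmin hlt hε hε1
  have hq0 : 0 ≤ q := hq ▸ Real.log_natCast_nonneg _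
  have hq2 : 2 ≤ q := by
    have hpos : 0 < q := by
      rcases hq0.lt_or_eq with h | h
      · exact h
      · rw [← h, Real.log_zero] at hlq
        norm_num at hlq
    have := (Real.le_log_iff_exp_le hpos).1 hlq
    linarith [Real.exp_one_gt_d9]
  subst hq hQ
  refine ⟨fun p hp => ?_, GibbsSampling.gibbsEstimator_accuracy H hn h0 hL hq2 hmin hlt.le hε hε1⟩
  have hcost := GibbsSampling.gibbsEstimator_cost H hL hq2 hε hε1 p hp
  set q := Real.log (Fintype.card Ω)
  set L := Real.log n
  set u := (ε ^ 2)⁻¹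
  have hu : 0 ≤ u := by positivity
  have hqLu : 0 ≤ q * L ^ 2 * u := by positivity
  have hmono : q * L ^ 2 * u ≤ q * u * (Real.log q + L) ^ 2 := by
    calc q * L ^ 2 * u = q * u * L ^ 2 := by ring
      _ ≤ _ := by gcongr; linarith
  have hfirst : 0 ≤ 5 * 10 ^ 5 * q * L ^ 2 * (Real.log q + L) ^ 2 := by positivity
  constructor
  · linarith
  · linarith
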